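/- Let $G=(V,E,r,s)$ be a directed graph ($V$, $E$ arbitrary sets, $s,r:E\to V$ the source and range maps). The graph inverse semigroup $I(G)$ is the semigroup with zero generated by $V\cup E\cup\{e^*:e\in E\}$ subject to the relations, for all $u,v\in V$ and $e,f\in E$: $uv=\delta_{u,v}u$; $s(e)e=e\,r(e)=e$; $r(e)e^*=e^*s(e)=e^*$; $f^*e=\delta_{f,e}r(e)$. A cycle is a sequence of edges $c=e_1\cdots e_n$ with $n\ge 1$, $r(e_i)=s(e_{i+1})$ for $1\le i<n$, $r(e_n)=s(e_1)=:s(c)$, and $s(e_i)\ne s(e_j)$ for $i\neq j$; its vertices are $s(e_1),\dots,s(e_n)$. For $W\subseteq V$ let $C(W)$ be the set of cycles all of whose vertices lie in $W$. A congruence $\rho$ on $I(G)$ is special if $(v,0)\notin\rho$ for all $v\in V$. A congruence pair of $G$ is a pair $(W,f)$, where $W\subseteq\{v\in V: |s^{-1}(v)|=1\}$ and $f:C(W)\to\{1,2,3,\dots\}\cup\{\infty\}$ is a cycle function, i.e. invariant under cyclic permutations of cycles. For $v\in W$, let $e_v$ denote the unique edge with source $v$. For a special congruence $\rho$, let $T(\rho)=(W,f)$,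 where $W$ is the set of all $v\in V$ such that $(ee^*,v)\in\rho$ for some edge $e$ with $s(e)=v$, and for $c\in C(W)$, $f(c)$ is the smallest positive integer $m$ with $(c^m,s(c))\in\rho$, or $f(c)=\infty$ if there is no such $m$. For a congruence pair $(W,f)$, let $\wp(W,f)$ be the congruence on $I(G)$ generated by all pairs $(e_ve_v^*,v)$ with $v\in W$ and all pairs $(c^{f(c)},s(c))$ with $c\in C(W)$ and $f(c)<\infty$. **Theorem.** For every directed graph $G$, $T$ is a well-defined map from the set of special congruences on $I(G)$ to the set of congruence pairs of $G$, $\wp$ is a well-defined map from the set of congruence pairs of $G$ to the set of special congruences on $I(G)$, and these two maps are inverse to each other. In particular, special congruences on $I(G)$ and congruence pairs of $G$ are in one-to-one correspondence. -/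

import Mathlib

universe u v

/-- A directed graph with vertex set `V`, edge set `E`, source map `s` and range map `r`
(loops and parallel edges are allowed, and nothing is assumed finite). -/
structure DirectedGraph (V : Type u) (E : Type v) where
  s : E → V
  r : E → V

namespace DirectedGraph

variable {V : Type u} {E : Type v}

/-! ### The graph inverse semigroup -/

/-- The generators: the vertices `v`, the edges `e`, and the ghost edges `e^*`. -/
inductive Gen (V : Type u) (E : Type v) : Type (max u v)
  | vertex (v : V) : Gen V E
  | edge (e : E) : Gen V E
  | ghost (e : E) : Gen V E

/-- The free semigroup with zero on the generators. -/
abbrev FreeWords (V : Type u) (E : Type v) : Type (max u v) :=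
  WithZero (FreeSemigroup (Gen V E))

/-- A generator as an element of the free semigroup with zero. -/
def Gen.word (g : Gen V E) : FreeWords V E :=
  ((FreeSemigroup.of g : FreeSemigroup (Gen V E)) : FreeWords V E)

/-- The defining relations (GI1), (GI2), (GI3), (CK1). -/
inductive InvRel (G : DirectedGraph V E) : FreeWords V E → FreeWords V E → Prop
  | vertex_mul_self (v : V) :
      InvRel G ((Gen.vertex v).word * (Gen.vertex v).word) (Gen.vertex v).word
  | vertex_mul_of_ne (u v : V) (h : u ≠ v) :
      InvRel G ((Gen.vertex u).word * (Gen.vertex v).word) 0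
  | source_mul_edge (e : E) :
      InvRel G ((Gen.vertex (G.s e)).word * (Gen.edge e).word) (Gen.edge e).word
  | edge_mul_range (e : E) :
      InvRel G ((Gen.edge e).word * (Gen.vertex (G.r e)).word) (Gen.edge e).word
  | range_mul_ghost (e : E) :
      InvRel G ((Gen.vertex (G.r e)).word * (Gen.ghost e).word) (Gen.ghost e).word
  | ghost_mul_source (e : E) :
      InvRel G ((Gen.ghost e).word * (Gen.vertex (G.s e)).word) (Gen.ghost e).word
  | ghost_mul_self (e : E) :
      InvRel G ((Gen.ghost e).word * (Gen.edge e).word) (Gen.vertex (G.r e)).word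
  | ghost_mul_of_ne (f e : E) (h : f ≠ e) :
      InvRel G ((Gen.ghost f).word * (Gen.edge e).word) 0

/-- The graph inverse semigroup of `G`: the semigroup with zero presented by the vertices, edges
and ghost edges subject to the relations `InvRel G`. -/
def Inv (G : DirectedGraph V E) : Type (max u v) :=
  (conGen (InvRel G)).Quotient

namespace Inv

/-- The canonical projection from words to the graph inverse semigroup. -/
def mk (G : DirectedGraph V E) (x : FreeWords V E) : G.Inv :=
  (conGen (InvRel G)).toQuotient x

instance (G : DirectedGraph V E) : Semigroup G.Inv :=
  inferInstanceAs (Semigroup (conGen (InvRel G)).Quotient)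

instance (G : DirectedGraph V E) : SemigroupWithZero G.Inv where
  zero := mk G 0
  zero_mul a := by
    refine Con.induction_on a fun x => ?_
    exact congrArg (mk G) (zero_mul x)
  mul_zero a := by
    refine Con.induction_on a fun x => ?_
    exact congrArg (mk G) (mul_zero x)

/-- The element `v` of the graph inverse semigroup. -/
def vertex (G : DirectedGraph V E) (v : V) : G.Inv := mk G (Gen.vertex v).word

/-- The element `e` of the graph inverse semigroup. -/
def edge (G : DirectedGraph V E) (e : E) : G.Inv := mk G (Gen.edge e).word

/-- The element `e^*` of the graph inverse semigroup. -/
def ghost (G : DirectedGraph V E) (e : E) : G.Inv := mk G (Gen.ghost e).word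

/-- The element `e₁ ⋯ eₙ` given by a path with edges `e₁, …, eₙ` and range `v`. It is written
`e₁ ⋯ eₙ v`, so that the path of length `0` at `v` gives `v`; for `n ≥ 1` the last factor is
absorbed, since `eₙ r(eₙ) = eₙ`. -/
def path (G : DirectedGraph V E) (l : List E) (v : V) : G.Inv :=
  l.foldr (fun e x => edge G e * x) (vertex G v)

end Inv

/-! ### Cycles and index -/

/-- A cycle `e₁ ⋯ eₙ`, `n ≥ 1`: consecutive edges are composable, the path is closed, and the
sources of the edges are pairwise distinct. -/
structure GraphCycle (G : DirectedGraph V E) where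
  edges : List E
  ne_nil : edges ≠ []
  isChain : edges.IsChain (fun e f => G.r e = G.s f)
  closed : G.r (edges.getLast ne_nil) = G.s (edges.head ne_nil)
  nodup : (edges.map G.s).Nodup

namespace GraphCycle

variable {G : DirectedGraph V E}

/-- The source `s(c) = s(e₁)` of a cycle; it is also its range. -/
def source (c : G.GraphCycle) : V := G.s (c.edges.head c.ne_nil)

/-- The set of vertices of a cycle. -/
def vertices (c : G.GraphCycle) : Set V := {v | ∃ e ∈ c.edges, G.s e = v}

/-- The power `c ^ m` in the graph inverse semigroup, with `c ^ 0 = s(c)`. -/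
def pow (c : G.GraphCycle) : ℕ → G.Inv
  | 0 => Inv.vertex G c.source
  | m + 1 => c.pow m * Inv.path G c.edges c.source

end GraphCycle

/-- The index `|s⁻¹(v)|` of a vertex. -/
noncomputable def index (G : DirectedGraph V E) (v : V) : ℕ∞ := (G.s ⁻¹' {v}).encard

/-- The set of cycles all of whose vertices lie in `W`. -/
def cyclesIn (G : DirectedGraph V E) (W : Set V) : Set G.GraphCycle := {c | c.vertices ⊆ W}

/-! ### Special congruences and congruence pairs -/

/-- A special congruence: no vertex is related to `0`. -/
def IsSpecial {G : DirectedGraph V E} (ρ : Con G.Inv) : Prop :=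
  ∀ v : V, ¬ ρ (Inv.vertex G v) 0

/-- The type of special congruences on the graph inverse semigroup. -/
abbrev SpecialCongruence (G : DirectedGraph V E) : Type (max u v) :=
  {ρ : Con G.Inv // IsSpecial ρ}

/-- A congruence pair `(W, f)`: a set `W` of vertices of index one and a cycle function `f` on the
cycles inside `W`, i.e. a function with values in `{1, 2, …} ∪ {∞}` that is invariant under cyclic
permutations. -/
structure CongruencePair (G : DirectedGraph V E) where
  W : Set V
  index_eq_one : ∀ v ∈ W, G.index v = 1
  f : G.cyclesIn W → ℕ∞
  f_ne_zero : ∀ c, f c ≠ 0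
  f_rotate : ∀ c d : G.cyclesIn W, c.1.edges ~r d.1.edges → f c = f d

/-- The set `W` attached to a congruence `ρ`: the vertices `v` such that `e e^* ρ v` for an edge
`e` with source `v`. -/
def vertexSet {G : DirectedGraph V E} (ρ : Con G.Inv) : Set V :=
  {v | ∃ e : E, G.s e = v ∧ ρ (Inv.edge G e * Inv.ghost G e) (Inv.vertex G v)}

/-- The value at the cycle `c` of the cycle function attached to `ρ`: the smallest positive integer
`m` such that `c ^ m ρ s(c)`, and `∞` if there is none (the infimum of the empty set). -/
noncomputable def cycleOrder {G : DirectedGraph V E} (ρ : Con G.Inv) (c : G.GraphCycle) : ℕ∞ :=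
  sInf {n : ℕ∞ | ∃ m : ℕ, n = m ∧ 0 < m ∧ ρ (c.pow m) (Inv.vertex G c.source)}

/-- The generating pairs `(e_v e_v^*, v)` for `v ∈ W` (with `e_v` the only edge with source `v`)
and `(c ^ f(c), s(c))` for the cycles `c` inside `W` with `f(c) < ∞`. -/
inductive PairRel {G : DirectedGraph V E} (P : G.CongruencePair) : G.Inv → G.Inv → Prop
  | edge (e : E) (h : G.s e ∈ P.W) :
      PairRel P (Inv.edge G e * Inv.ghost G e) (Inv.vertex G (G.s e))
  | cycle (c : G.cyclesIn P.W) (m : ℕ) (h : P.f c = m) :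
      PairRel P (c.1.pow m) (Inv.vertex G c.1.source)

/-- The congruence `℘(W, f)` generated by the pairs above. -/
def CongruencePair.toCon {G : DirectedGraph V E} (P : G.CongruencePair) : Con G.Inv :=
  conGen (PairRel P)

/-- `P = T(ρ)`: the pair `P = (W, f)` is the one attached to the congruence `ρ`. -/
def IsPairOf {G : DirectedGraph V E} (ρ : Con G.Inv) (P : G.CongruencePair) : Prop :=
  P.W = vertexSet ρ ∧ ∀ c : G.cyclesIn P.W, P.f c = cycleOrder ρ c.1

end DirectedGraph

namespace DirectedGraph

variable {V : Type u} {E : Type v}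

/-! ### Relations in the graph inverse semigroup -/

namespace Inv

variable (G : DirectedGraph V E)

/-! Every nonzero element is `p q^*` for paths `p`, `q` with a common range, and a special
congruence `ρ` never relates such an element to `0`.

To see that `℘(T(ρ)) = ρ`, suppose `p q^* ρ y`. Compressing by `p^*` on the left and `q` on the
right gives `r(p) ρ p^* y q`, so the main case is a relation `v ρ z` with `z = p q^*`. Multiplying
by `p p^*` and by `q q^*` gives `v ρ p p^*` and `v ρ q q^*`, which puts the sources of all edges of
`p` and `q` in `W`. These vertices have index one, so one path extends the other by a closed path
`t` inside `W`, and `t` is a power of a cycle. Hence the relation follows from the generators of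
`℘(T(ρ))` (`vertex_rel`). Commuting projections `p p^*` then glue the compressed relations back
together (`pair_toCon_eq`).

To see that `T(℘(W, f)) = (W, f)`, one must bound the collapse from above, which a representation by
partial maps does. A state is a current vertex, a stack of edges and an element of an abelian group.
An edge with source outside `W` pushes itself on the stack and its ghost pops it; an edge with
source in `W` translates the group element and its ghost translates back. The weights are chosen so
that a cycle `c` in `W` acts at its source by a translation of order exactly `f(c)`. The generating
pairs hold in this action, and it separates vertices from `0`, from `e e^*` for `s(e) ∉ W`, and from
`c^m` unless `f(c) ∣ m`. -/

theorem mk_eq_of_rel {x y : FreeWords V E} (h : InvRel G x y) : mk G x = mk G y :=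
  (Con.eq _).2 (ConGen.Rel.of _ _ h)

theorem mk_mul (x y : FreeWords V E) : mk G (x * y) = mk G x * mk G y := rfl

theorem vertex_mul_self (v : V) : vertex G v * vertex G v = vertex G v :=
  mk_eq_of_rel G (.vertex_mul_self v)

theorem vertex_mul_of_ne {u v : V} (h : u ≠ v) : vertex G u * vertex G v = 0 :=
  mk_eq_of_rel G (.vertex_mul_of_ne u v h)

theorem source_mul_edge (e : E) : vertex G (G.s e) * edge G e = edge G e :=
  mk_eq_of_rel G (.source_mul_edge e)

theorem edge_mul_range (e : E) : edge G e * vertex G (G.r e) = edge G e :=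
  mk_eq_of_rel G (.edge_mul_range e)

theorem range_mul_ghost (e : E) : vertex G (G.r e) * ghost G e = ghost G e :=
  mk_eq_of_rel G (.range_mul_ghost e)

theorem ghost_mul_source (e : E) : ghost G e * vertex G (G.s e) = ghost G e :=
  mk_eq_of_rel G (.ghost_mul_source e)

theorem ghost_mul_edge_self (e : E) : ghost G e * edge G e = vertex G (G.r e) :=
  mk_eq_of_rel G (.ghost_mul_self e)

theorem ghost_mul_edge_of_ne {f e : E} (h : f ≠ e) : ghost G f * edge G e = 0 :=
  mk_eq_of_rel G (.ghost_mul_of_ne f e h)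

/-- The element `eₙ^* ⋯ e₁^*` given by a path with edges `e₁, …, eₙ` and range `v`. -/
def ghostPath (l : List E) (v : V) : G.Inv :=
  l.foldr (fun e x => x * ghost G e) (vertex G v)

@[simp] theorem path_nil (v : V) : path G [] v = vertex G v := rfl

@[simp] theorem path_cons (e : E) (l : List E) (v : V) :
    path G (e :: l) v = edge G e * path G l v := rfl

@[simp] theorem ghostPath_nil (v : V) : ghostPath G [] v = vertex G v := rfl

@[simp] theorem ghostPath_cons (e : E) (l : List E) (v : V) :
    ghostPath G (e :: l) v = ghostPath G l v * ghost G e := rfl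

end Inv

/-- The list `l` consists of the edges of a path from `a` to `b`. -/
def IsPath (G : DirectedGraph V E) : List E → V → V → Prop
  | [], a, b => a = b
  | e :: l, a, b => G.s e = a ∧ IsPath G l (G.r e) b

/-! ### Paths, their projections, and the normal form `p q^*`. -/

section Path

variable {G : DirectedGraph V E}

@[simp] theorem isPath_nil {a b : V} : G.IsPath [] a b ↔ a = b := Iff.rfl

@[simp] theorem isPath_cons {e : E} {l : List E} {a b : V} :
    G.IsPath (e :: l) a b ↔ G.s e = a ∧ G.IsPath l (G.r e) b := Iff.rfl

theorem isPath_append {l l' : List E} {a c : V} :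
    G.IsPath (l ++ l') a c ↔ ∃ b, G.IsPath l a b ∧ G.IsPath l' b c := by
  induction l generalizing a with
  | nil => simp
  | cons e l ih => simp [ih, and_assoc]

theorem IsPath.source_unique {l : List E} {a a' b b' : V} (hl : l ≠ []) (h : G.IsPath l a b)
    (h' : G.IsPath l a' b') : a = a' := by
  cases l with
  | nil => exact absurd rfl hl
  | cons e l => exact h.1.symm.trans h'.1

theorem IsPath.range_unique {l : List E} {a b b' : V} (h : G.IsPath l a b)
    (h' : G.IsPath l a b') : b = b' := by
  induction l generalizing a with
  | nil => exact h.symm.trans h'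
  | cons e l ih => exact ih h.2 h'.2

theorem isPath_of_isChain {l : List E} (hl : l ≠ [])
    (h : l.IsChain (fun e f => G.r e = G.s f)) :
    G.IsPath l (G.s (l.head hl)) (G.r (l.getLast hl)) := by
  induction l with
  | nil => exact absurd rfl hl
  | cons e l ih =>
    cases l with
    | nil => simp
    | cons f l =>
      rw [List.isChain_cons_cons] at h
      refine ⟨rfl, ?_⟩
      rw [h.1, List.getLast_cons (List.cons_ne_nil f l)]
      exact ih (List.cons_ne_nil f l) h.2

theorem IsPath.isChain {l : List E} {a b : V} (h : G.IsPath l a b) :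
    l.IsChain (fun e f => G.r e = G.s f) := by
  induction l generalizing a with
  | nil => simp
  | cons e l ih =>
    cases l with
    | nil => simp
    | cons f l => exact List.isChain_cons_cons.2 ⟨h.2.1.symm, ih h.2⟩

theorem IsPath.head_eq {l : List E} {a b : V} (h : G.IsPath l a b) (hl : l ≠ []) :
    G.s (l.head hl) = a := by
  cases l with
  | nil => exact absurd rfl hl
  | cons e l => exact h.1

theorem IsPath.getLast_eq {l : List E} {a b : V} (h : G.IsPath l a b) (hl : l ≠ []) :
    G.r (l.getLast hl) = b :=
  (isPath_of_isChain hl h.isChain).range_unique (by rwa [h.head_eq hl])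

theorem IsPath.vertex_mul_path {l : List E} {a b : V} (h : G.IsPath l a b) :
    Inv.vertex G a * Inv.path G l b = Inv.path G l b := by
  cases l with
  | nil => cases h; exact Inv.vertex_mul_self G a
  | cons e l => rw [Inv.path_cons, ← mul_assoc, ← h.1, Inv.source_mul_edge]

theorem IsPath.ghostPath_mul_vertex {l : List E} {a b : V} (h : G.IsPath l a b) :
    Inv.ghostPath G l b * Inv.vertex G a = Inv.ghostPath G l b := by
  cases l with
  | nil => cases h; exact Inv.vertex_mul_self G a
  | cons e l => rw [Inv.ghostPath_cons, mul_assoc, ← h.1, Inv.ghost_mul_source]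

theorem path_mul_vertex (l : List E) (b : V) :
    Inv.path G l b * Inv.vertex G b = Inv.path G l b := by
  induction l with
  | nil => exact Inv.vertex_mul_self G b
  | cons e l ih => rw [Inv.path_cons, mul_assoc, ih]

theorem vertex_mul_ghostPath (l : List E) (b : V) :
    Inv.vertex G b * Inv.ghostPath G l b = Inv.ghostPath G l b := by
  induction l with
  | nil => exact Inv.vertex_mul_self G b
  | cons e l ih => rw [Inv.ghostPath_cons, ← mul_assoc, ih]

theorem IsPath.path_append {l l' : List E} {b c : V} (h' : G.IsPath l' b c) :
    Inv.path G (l ++ l') c = Inv.path G l b * Inv.path G l' c := by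
  induction l with
  | nil => exact h'.vertex_mul_path.symm
  | cons e l ih => rw [List.cons_append, Inv.path_cons, Inv.path_cons, ih, mul_assoc]

theorem IsPath.ghostPath_append {l l' : List E} {b c : V} (h' : G.IsPath l' b c) :
    Inv.ghostPath G (l ++ l') c = Inv.ghostPath G l' c * Inv.ghostPath G l b := by
  induction l with
  | nil => exact h'.ghostPath_mul_vertex.symm
  | cons e l ih => rw [List.cons_append, Inv.ghostPath_cons, Inv.ghostPath_cons, ih, mul_assoc]

theorem IsPath.ghostPath_mul_path {l : List E} {a b : V} (h : G.IsPath l a b) :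
    Inv.ghostPath G l b * Inv.path G l b = Inv.vertex G b := by
  induction l generalizing a with
  | nil => exact Inv.vertex_mul_self G b
  | cons e l ih =>
    rw [Inv.ghostPath_cons, Inv.path_cons, mul_assoc, ← mul_assoc (Inv.ghost G e),
      Inv.ghost_mul_edge_self, h.2.vertex_mul_path, ih h.2]

theorem IsPath.vertex_mul_path_of_ne {l : List E} {a b v : V} (h : G.IsPath l a b) (hv : v ≠ a) :
    Inv.vertex G v * Inv.path G l b = 0 := by
  rw [← h.vertex_mul_path, ← mul_assoc, Inv.vertex_mul_of_ne G hv, zero_mul]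

theorem IsPath.ghostPath_mul_vertex_of_ne {l : List E} {a b v : V} (h : G.IsPath l a b)
    (hv : a ≠ v) : Inv.ghostPath G l b * Inv.vertex G v = 0 := by
  rw [← h.ghostPath_mul_vertex, mul_assoc, Inv.vertex_mul_of_ne G hv, mul_zero]

/-- Two paths are either comparable in the prefix order, or the products of one with the ghost of
the other vanish. -/
theorem IsPath.comparable_or_mul_eq_zero {l l' : List E} {a a' b b' : V} (h : G.IsPath l a b)
    (h' : G.IsPath l' a' b') :
    (a = a' ∧ ((∃ t, l' = l ++ t) ∨ ∃ t, l = l' ++ t)) ∨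
      (Inv.ghostPath G l b * Inv.path G l' b' = 0 ∧
        Inv.ghostPath G l' b' * Inv.path G l b = 0) := by
  by_cases haa : a = a'
  swap
  · refine Or.inr ⟨?_, ?_⟩
    · rw [← h'.vertex_mul_path, ← mul_assoc, h.ghostPath_mul_vertex_of_ne haa, zero_mul]
    · rw [← h.vertex_mul_path, ← mul_assoc, h'.ghostPath_mul_vertex_of_ne (Ne.symm haa), zero_mul]
  subst haa
  induction l generalizing l' a with
  | nil => exact Or.inl ⟨rfl, Or.inl ⟨l', rfl⟩⟩
  | cons e l ih =>
    cases l' with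
    | nil => exact Or.inl ⟨rfl, Or.inr ⟨e :: l, rfl⟩⟩
    | cons f l' =>
      by_cases hef : e = f
      · subst hef
        rcases ih h.2 h'.2 with ⟨-, ⟨t, ht⟩ | ⟨t, ht⟩⟩ | ⟨h1, h2⟩
        · exact Or.inl ⟨rfl, Or.inl ⟨t, by rw [ht, List.cons_append]⟩⟩
        · exact Or.inl ⟨rfl, Or.inr ⟨t, by rw [ht, List.cons_append]⟩⟩
        · refine Or.inr ⟨?_, ?_⟩
          · rw [Inv.ghostPath_cons, Inv.path_cons, mul_assoc, ← mul_assoc (Inv.ghost G e),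
              Inv.ghost_mul_edge_self, h'.2.vertex_mul_path, h1]
          · rw [Inv.ghostPath_cons, Inv.path_cons, mul_assoc, ← mul_assoc (Inv.ghost G e),
              Inv.ghost_mul_edge_self, h.2.vertex_mul_path, h2]
      · refine Or.inr ⟨?_, ?_⟩
        · rw [Inv.ghostPath_cons, Inv.path_cons, mul_assoc, ← mul_assoc (Inv.ghost G e),
            Inv.ghost_mul_edge_of_ne G hef, zero_mul, mul_zero]
        · rw [Inv.ghostPath_cons, Inv.path_cons, mul_assoc, ← mul_assoc (Inv.ghost G f),
            Inv.ghost_mul_edge_of_ne G (Ne.symm hef), zero_mul, mul_zero]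

/-- The idempotent `p p^*` of a path. -/
def Inv.proj (G : DirectedGraph V E) (l : List E) (b : V) : G.Inv :=
  Inv.path G l b * Inv.ghostPath G l b

theorem IsPath.proj_mul_path {l : List E} {a b : V} (h : G.IsPath l a b) :
    Inv.proj G l b * Inv.path G l b = Inv.path G l b := by
  rw [Inv.proj, mul_assoc, h.ghostPath_mul_path, path_mul_vertex]

theorem IsPath.ghostPath_mul_proj {l : List E} {a b : V} (h : G.IsPath l a b) :
    Inv.ghostPath G l b * Inv.proj G l b = Inv.ghostPath G l b := by
  rw [Inv.proj, ← mul_assoc, h.ghostPath_mul_path, vertex_mul_ghostPath]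

theorem IsPath.proj_mul_proj_append {l t : List E} {a b c : V} (h : G.IsPath l a b)
    (ht : G.IsPath t b c) :
    Inv.proj G l b * Inv.proj G (l ++ t) c = Inv.proj G (l ++ t) c := by
  rw [Inv.proj.eq_1 G (l ++ t), ht.path_append, ← mul_assoc, ← mul_assoc, h.proj_mul_path]

theorem IsPath.proj_append_mul_proj {l t : List E} {a b c : V} (h : G.IsPath l a b)
    (ht : G.IsPath t b c) :
    Inv.proj G (l ++ t) c * Inv.proj G l b = Inv.proj G (l ++ t) c := by
  rw [Inv.proj.eq_1 G (l ++ t), ht.ghostPath_append, mul_assoc, mul_assoc, h.ghostPath_mul_proj]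

/-- For comparable paths both products equal the projection of the longer one; otherwise both
vanish. -/
theorem IsPath.proj_mul_comm {l l' : List E} {a a' b b' : V} (h : G.IsPath l a b)
    (h' : G.IsPath l' a' b') :
    Inv.proj G l b * Inv.proj G l' b' = Inv.proj G l' b' * Inv.proj G l b := by
  rcases h.comparable_or_mul_eq_zero h' with ⟨rfl, ⟨t, rfl⟩ | ⟨t, rfl⟩⟩ | ⟨h1, h2⟩
  · obtain ⟨m, hm, ht⟩ := isPath_append.1 h'
    obtain rfl := h.range_unique hm
    rw [h.proj_mul_proj_append ht, h.proj_append_mul_proj ht]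
  · obtain ⟨m, hm, ht⟩ := isPath_append.1 h
    obtain rfl := h'.range_unique hm
    rw [h'.proj_mul_proj_append ht, h'.proj_append_mul_proj ht]
  · rw [Inv.proj, Inv.proj, mul_assoc, ← mul_assoc (Inv.ghostPath G l b), h1, zero_mul, mul_zero,
      mul_assoc, ← mul_assoc (Inv.ghostPath G l' b'), h2, zero_mul, mul_zero]

/-- The element `x` has the form `p q^*` for two paths `p`, `q` with the same range. -/
def IsNormalForm (x : G.Inv) : Prop :=
  ∃ (p q : List E) (a a' b : V), G.IsPath p a b ∧ G.IsPath q a' b ∧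
    x = Inv.path G p b * Inv.ghostPath G q b

theorem isNormalForm_vertex (v : V) : IsNormalForm (Inv.vertex G v) :=
  ⟨[], [], v, v, v, rfl, rfl, (Inv.vertex_mul_self G v).symm⟩

theorem isNormalForm_edge (e : E) : IsNormalForm (Inv.edge G e) :=
  ⟨[e], [], G.s e, G.r e, G.r e, by simp, rfl, by
    simp [Inv.edge_mul_range]⟩

theorem isNormalForm_ghost (e : E) : IsNormalForm (Inv.ghost G e) :=
  ⟨[], [e], G.r e, G.s e, G.r e, rfl, by simp, by
    simp [Inv.range_mul_ghost]⟩

theorem isNormalForm_vertex_mul (v : V) {x : G.Inv} (hx : IsNormalForm x) :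
    Inv.vertex G v * x = 0 ∨ IsNormalForm (Inv.vertex G v * x) := by
  obtain ⟨p, q, a, a', b, hp, hq, rfl⟩ := hx
  by_cases h : v = a
  · subst h
    rw [← mul_assoc, hp.vertex_mul_path]
    exact Or.inr ⟨p, q, v, a', b, hp, hq, rfl⟩
  · left
    rw [← mul_assoc, hp.vertex_mul_path_of_ne h, zero_mul]

theorem isNormalForm_edge_mul (e : E) {x : G.Inv} (hx : IsNormalForm x) :
    Inv.edge G e * x = 0 ∨ IsNormalForm (Inv.edge G e * x) := by
  obtain ⟨p, q, a, a', b, hp, hq, rfl⟩ := hx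
  by_cases h : G.r e = a
  · subst h
    exact Or.inr ⟨e :: p, q, G.s e, a', b, ⟨rfl, hp⟩, hq, by rw [Inv.path_cons, mul_assoc]⟩
  · left
    rw [← Inv.edge_mul_range, mul_assoc, ← mul_assoc (Inv.vertex G _),
      hp.vertex_mul_path_of_ne h, zero_mul, mul_zero]

/-- A ghost edge either cancels the first edge of `p` or, when `p` is empty, is absorbed at the end
of `q`. -/
theorem isNormalForm_ghost_mul (e : E) {x : G.Inv} (hx : IsNormalForm x) :
    Inv.ghost G e * x = 0 ∨ IsNormalForm (Inv.ghost G e * x) := by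
  obtain ⟨p, q, a, a', b, hp, hq, rfl⟩ := hx
  cases p with
  | nil =>
    cases hp
    rw [Inv.path_nil, vertex_mul_ghostPath]
    by_cases h : G.s e = a
    · subst h
      have he : G.IsPath [e] (G.s e) (G.r e) := by simp
      refine Or.inr ⟨[], q ++ [e], G.r e, a', G.r e, rfl, isPath_append.2 ⟨_, hq, he⟩, ?_⟩
      rw [Inv.path_nil, vertex_mul_ghostPath, he.ghostPath_append, Inv.ghostPath_cons,
        Inv.ghostPath_nil, Inv.range_mul_ghost]
    · left
      rw [← vertex_mul_ghostPath, ← mul_assoc, ← Inv.ghost_mul_source, mul_assoc (Inv.ghost G e),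
        Inv.vertex_mul_of_ne G h, mul_zero, zero_mul]
  | cons f p =>
    by_cases h : e = f
    · subst h
      rw [Inv.path_cons, mul_assoc, ← mul_assoc, Inv.ghost_mul_edge_self, ← mul_assoc,
        hp.2.vertex_mul_path]
      exact Or.inr ⟨p, q, _, a', b, hp.2, hq, rfl⟩
    · left
      rw [Inv.path_cons, mul_assoc, ← mul_assoc, Inv.ghost_mul_edge_of_ne G h, zero_mul]

/-- Every element of the graph inverse semigroup is `0` or of the form `p q^*`. -/
theorem eq_zero_or_isNormalForm (x : G.Inv) : x = 0 ∨ IsNormalForm x := by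
  refine Con.induction_on x fun w => ?_
  change Inv.mk G w = 0 ∨ IsNormalForm (Inv.mk G w)
  induction w using WithZero.recZeroCoe with
  | zero => exact Or.inl rfl
  | coe w =>
    induction w using FreeSemigroup.recOnMul with
    | ih1 g =>
      right
      cases g with
      | vertex v => exact isNormalForm_vertex v
      | edge e => exact isNormalForm_edge e
      | ghost e => exact isNormalForm_ghost e
    | ih2 g w _ ih =>
      rw [WithZero.coe_mul, Inv.mk_mul]
      rcases ih with h | h
      · left; rw [h, mul_zero]
      · cases g with
        | vertex v => exact isNormalForm_vertex_mul v h
        | edge e => exact isNormalForm_edge_mul e h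
        | ghost e => exact isNormalForm_ghost_mul e h

end Path

/-! ### Closed paths and cycles -/

section Cycle

variable {G : DirectedGraph V E}

theorem eq_of_index_eq_one {v : V} (hv : G.index v = 1) {e f : E} (he : G.s e = v)
    (hf : G.s f = v) : e = f := by
  obtain ⟨x, hx⟩ := Set.encard_eq_one.1 hv
  have h1 : e ∈ G.s ⁻¹' {v} := he
  have h2 : f ∈ G.s ⁻¹' {v} := hf
  rw [hx] at h1 h2
  exact h1.trans h2.symm

theorem exists_edge_of_index_eq_one {v : V} (hv : G.index v = 1) : ∃ e, G.s e = v := by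
  obtain ⟨x, hx⟩ := Set.encard_eq_one.1 hv
  exact ⟨x, (hx ▸ Set.mem_singleton x : x ∈ G.s ⁻¹' {v})⟩

/-- Two paths with the same source are comparable in the prefix order if the vertices of one of
them have index one. -/
theorem IsPath.comparable {W : Set V} (hW : ∀ v ∈ W, G.index v = 1) {p q : List E} {a b c : V}
    (hp : G.IsPath p a b) (hq : G.IsPath q a c) (hpW : ∀ e ∈ p, G.s e ∈ W) :
    (∃ t, q = p ++ t) ∨ ∃ t, p = q ++ t := by
  induction p generalizing q a with
  | nil => exact Or.inl ⟨q, rfl⟩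
  | cons e p ih =>
    cases q with
    | nil => exact Or.inr ⟨e :: p, rfl⟩
    | cons f q =>
      obtain rfl : e = f :=
        eq_of_index_eq_one (hW _ (hpW e List.mem_cons_self)) rfl (hq.1.trans hp.1.symm)
      rcases ih hp.2 hq.2 (fun x hx => hpW x (List.mem_cons_of_mem e hx)) with ⟨t, ht⟩ | ⟨t, ht⟩
      · exact Or.inl ⟨t, by rw [ht, List.cons_append]⟩
      · exact Or.inr ⟨t, by rw [ht, List.cons_append]⟩

namespace GraphCycle

theorem isPath (c : G.GraphCycle) : G.IsPath c.edges c.source c.source := by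
  have h := isPath_of_isChain c.ne_nil c.isChain
  rwa [c.closed] at h

theorem source_eq (c : G.GraphCycle) {a b : V} (h : G.IsPath c.edges a b) : c.source = a :=
  c.isPath.source_unique c.ne_nil h

theorem pow_succ (c : G.GraphCycle) (m : ℕ) :
    c.pow (m + 1) = c.pow m * Inv.path G c.edges c.source := rfl

theorem pow_mul_vertex (c : G.GraphCycle) (m : ℕ) :
    c.pow m * Inv.vertex G c.source = c.pow m := by
  cases m with
  | zero => exact Inv.vertex_mul_self G _
  | succ m => rw [pow_succ, mul_assoc, path_mul_vertex]

theorem path_mul_pow (c : G.GraphCycle) (m : ℕ) :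
    Inv.path G c.edges c.source * c.pow m = c.pow (m + 1) := by
  induction m with
  | zero =>
    exact (path_mul_vertex _ _).trans c.isPath.vertex_mul_path.symm
  | succ m ih => rw [c.pow_succ m, ← mul_assoc, ih, ← c.pow_succ]

theorem pow_add (c : G.GraphCycle) (j k : ℕ) : c.pow (j + k) = c.pow j * c.pow k := by
  induction k with
  | zero => exact (c.pow_mul_vertex j).symm
  | succ k ih => rw [← add_assoc, pow_succ, ih, pow_succ, mul_assoc]

/-- With `c = xy` and `d = yx`, this is `(xy)^m x = x (yx)^m`; conjugating by `x` then transfers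
relations between rotations. -/
theorem pow_mul_path_of_rotate {c d : G.GraphCycle} {x y : List E} (hc : c.edges = x ++ y)
    (hd : d.edges = y ++ x) :
    G.IsPath x c.source d.source ∧
      ∀ m, c.pow m * Inv.path G x d.source = Inv.path G x d.source * d.pow m := by
  obtain ⟨b, hx, hy⟩ := isPath_append.1 (hc ▸ c.isPath)
  obtain rfl : d.source = b := d.source_eq (hd ▸ isPath_append.2 ⟨_, hy, hx⟩)
  refine ⟨hx, fun m => ?_⟩
  induction m with
  | zero => exact hx.vertex_mul_path.trans (path_mul_vertex _ _).symm
  | succ m ih =>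
    rw [pow_succ, pow_succ, hc, hd, hx.path_append, hy.path_append, ← mul_assoc, ← mul_assoc,
      ← mul_assoc, ih]

theorem rel_pow_of_rotate (ρ : Con G.Inv) {c d : G.GraphCycle} (h : c.edges ~r d.edges) {m : ℕ}
    (hm : ρ (c.pow m) (Inv.vertex G c.source)) : ρ (d.pow m) (Inv.vertex G d.source) := by
  obtain ⟨n, hn⟩ := h
  rw [List.rotate_eq_drop_append_take_mod] at hn
  obtain ⟨hx, hpow⟩ := pow_mul_path_of_rotate
    (List.take_append_drop (n % c.edges.length) c.edges).symm hn.symm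
  have h1 := ρ.mul
    (ρ.mul (ρ.refl (Inv.ghostPath G (c.edges.take (n % c.edges.length)) d.source)) hm)
    (ρ.refl (Inv.path G (c.edges.take (n % c.edges.length)) d.source))
  rw [mul_assoc, hpow, ← mul_assoc, hx.ghostPath_mul_path, hx.ghostPath_mul_vertex,
    hx.ghostPath_mul_path] at h1
  have h2 : Inv.vertex G d.source * d.pow m = d.pow m := by
    rw [show Inv.vertex G d.source = d.pow 0 from rfl, ← d.pow_add, zero_add]
  rwa [h2] at h1

end GraphCycle

/-- A nonempty closed path with vertices of index one is a power of a cycle. -/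
theorem exists_cycle_pow_eq {W : Set V} (hW : ∀ v ∈ W, G.index v = 1) {l : List E} {b : V}
    (hl : l ≠ []) (h : G.IsPath l b b) (hlW : ∀ e ∈ l, G.s e ∈ W) :
    ∃ c ∈ G.cyclesIn W, c.source = b ∧ ∃ k, Inv.path G l b = c.pow k := by
  classical
  -- The cycle is a shortest nonempty closed path `w` at `b` inside `W`.
  let Q : ℕ → Prop := fun n => ∃ c : List E, c.length = n ∧ c ≠ [] ∧ G.IsPath c b b ∧
    ∀ e ∈ c, G.s e ∈ W
  have hQ : ∃ n, Q n := ⟨_, l, rfl, hl, h, hlW⟩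
  obtain ⟨w, hcn, hc0, hc, hcW⟩ := Nat.find_spec hQ
  have hmin : ∀ c' : List E, c' ≠ [] → G.IsPath c' b b → (∀ e ∈ c', G.s e ∈ W) →
      w.length ≤ c'.length := fun c' h0 h1 h2 => by
    rw [hcn]; exact Nat.find_min' hQ ⟨c', rfl, h0, h1, h2⟩
  -- A repeated vertex would allow the segment between its two occurrences to be cut out,
  -- contradicting minimality.
  have hnodup : (w.map G.s).Nodup := by
    rw [List.nodup_iff_getElem?_ne_getElem?]
    intro i j hij hj heq
    rw [List.length_map] at hj
    rw [List.getElem?_map, List.getElem?_map, List.getElem?_eq_getElem hj,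
      List.getElem?_eq_getElem (hij.trans hj)] at heq
    have hs : G.s w[i] = G.s w[j] := by simpa using heq
    have h1 := hc
    rw [← List.take_append_drop i w] at h1
    obtain ⟨m, hm, hm'⟩ := isPath_append.1 h1
    have h2 := hc
    rw [← List.take_append_drop j w] at h2
    obtain ⟨m₂, -, hm₂'⟩ := isPath_append.1 h2
    rw [List.drop_eq_getElem_cons (hij.trans hj)] at hm'
    have hmm : m₂ = m := by
      have := hm₂'
      rw [List.drop_eq_getElem_cons hj] at this
      rw [← this.1, ← hm'.1, hs]
    have hlen := hmin (w.take i ++ w.drop j)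
      (by rw [List.drop_eq_getElem_cons hj]
          exact List.append_ne_nil_of_right_ne_nil _ (List.cons_ne_nil _ _))
      (isPath_append.2 ⟨m, hm, hmm ▸ hm₂'⟩)
      (fun e he => by
        rcases List.mem_append.1 he with he | he
        · exact hcW e (List.mem_of_mem_take he)
        · exact hcW e (List.mem_of_mem_drop he))
    rw [List.length_append, List.length_take, List.length_drop] at hlen
    omega
  let C : G.GraphCycle :=
    { edges := w
      ne_nil := hc0
      isChain := hc.isChain
      closed := by rw [hc.head_eq hc0, hc.getLast_eq hc0]
      nodup := hnodup }
  have hCb : C.source = b := C.source_eq hc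
  refine ⟨C, ?_, hCb, ?_⟩
  · rintro _ ⟨e, he, rfl⟩
    exact hcW e he
  · clear hQ hcn
    generalize hn : l.length = n
    induction n using Nat.strong_induction_on generalizing l with
    | _ n ih =>
      -- Index one makes `w` and `l` comparable, and minimality of `w` makes it the prefix; the
      -- remainder `t` is again closed at `b`.
      have key : ∃ t, l = w ++ t := by
        rcases hc.comparable hW h hcW with ht | ⟨t, ht⟩
        · exact ht
        · refine ⟨[], ?_⟩
          have h1 := hmin l hl h hlW
          have h2 := congrArg List.length ht
          rw [List.length_append] at h2
          have h3 : t = [] := List.eq_nil_of_length_eq_zero (by omega)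
          rw [ht, h3, List.append_nil, List.append_nil]
      obtain ⟨t, rfl⟩ := key
      obtain ⟨m, hm, ht⟩ := isPath_append.1 h
      obtain rfl := hc.range_unique hm
      have hrec : ∃ k, Inv.path G t b = C.pow k := by
        by_cases ht0 : t = []
        · exact ⟨0, by subst ht0; rw [← hCb]; rfl⟩
        · refine ih t.length ?_ ht0 ht (fun e he => hlW e (List.mem_append_right _ he)) rfl
          rw [← hn, List.length_append]
          have := List.length_pos_of_ne_nil hc0
          omega
      obtain ⟨k, hk⟩ := hrec
      refine ⟨k + 1, ?_⟩
      rw [ht.path_append, hk, ← C.path_mul_pow, hCb]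

end Cycle

/-! ### The congruence pair of a special congruence -/

section Special

variable {G : DirectedGraph V E}

/-- Since `p^* (p q^*) q` is the common range vertex, sending `p q^*` to `0` would send a vertex to
`0`. -/
theorem IsSpecial.not_rel_zero {ρ : Con G.Inv} (hρ : IsSpecial ρ) {x : G.Inv}
    (hx : IsNormalForm x) : ¬ ρ x 0 := by
  obtain ⟨p, q, a, a', b, hp, hq, rfl⟩ := hx
  intro h
  have h1 := ρ.mul (ρ.mul (ρ.refl (Inv.ghostPath G p b)) h) (ρ.refl (Inv.path G q b))
  rw [← mul_assoc, hp.ghostPath_mul_path, mul_assoc, mul_assoc, hq.ghostPath_mul_path, zero_mul,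
    mul_zero, Inv.vertex_mul_self] at h1
  exact hρ b h1

/-- For a second edge `f` at `v`, multiplying `e e^* ρ v` by `f^*` gives `0 ρ f^*`. -/
theorem IsSpecial.index_eq_one {ρ : Con G.Inv} (hρ : IsSpecial ρ) {v : V}
    (hv : v ∈ vertexSet ρ) : G.index v = 1 := by
  obtain ⟨e, rfl, h⟩ := hv
  refine Set.encard_eq_one.2 ⟨e, Set.eq_singleton_iff_unique_mem.2 ⟨rfl, fun f hf => ?_⟩⟩
  by_contra hfe
  refine hρ.not_rel_zero (isNormalForm_ghost f) (ρ.symm ?_)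
  have h1 := ρ.mul (ρ.refl (Inv.ghost G f)) h
  rw [← mul_assoc, Inv.ghost_mul_edge_of_ne G hfe, zero_mul,
    ← show G.s f = G.s e from hf, Inv.ghost_mul_source] at h1
  exact h1

theorem cycleOrder_ne_zero (ρ : Con G.Inv) (c : G.GraphCycle) : cycleOrder ρ c ≠ 0 := by
  refine (lt_of_lt_of_le zero_lt_one (le_sInf ?_)).ne'
  rintro n ⟨m, rfl, hm, -⟩
  exact_mod_cast hm

theorem cycleOrder_eq_of_rotate (ρ : Con G.Inv) {c d : G.GraphCycle} (h : c.edges ~r d.edges) :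
    cycleOrder ρ c = cycleOrder ρ d := by
  refine congrArg sInf (Set.ext fun n => ?_)
  constructor
  · rintro ⟨m, hn, hm, hr⟩
    exact ⟨m, hn, hm, GraphCycle.rel_pow_of_rotate ρ h hr⟩
  · rintro ⟨m, hn, hm, hr⟩
    exact ⟨m, hn, hm, GraphCycle.rel_pow_of_rotate ρ h.symm hr⟩

theorem rel_pow_of_cycleOrder_eq {ρ : Con G.Inv} {c : G.GraphCycle} {m : ℕ}
    (h : cycleOrder ρ c = m) : ρ (c.pow m) (Inv.vertex G c.source) := by
  have hne : {n : ℕ∞ | ∃ m : ℕ, n = m ∧ 0 < m ∧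
      ρ (c.pow m) (Inv.vertex G c.source)}.Nonempty := by
    -- The infimum of the empty set is `∞`, so a finite value is an attained minimum.
    by_contra hempty
    rw [Set.not_nonempty_iff_eq_empty] at hempty
    rw [cycleOrder, hempty, sInf_empty] at h
    exact ENat.natCast_ne_top m h.symm
  obtain ⟨k, hk, -, hr⟩ := csInf_mem hne
  have : k = m := by exact_mod_cast hk.symm.trans h
  rwa [this] at hr

theorem exists_cycleOrder_eq {ρ : Con G.Inv} {c : G.GraphCycle} {m : ℕ} (hm : 0 < m)
    (h : ρ (c.pow m) (Inv.vertex G c.source)) :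
    ∃ n : ℕ, 0 < n ∧ n ≤ m ∧ cycleOrder ρ c = n := by
  have hle : cycleOrder ρ c ≤ m := sInf_le ⟨m, rfl, hm, h⟩
  obtain ⟨n, hn⟩ := ENat.ne_top_iff_exists.1 (ne_top_of_le_ne_top (ENat.natCast_ne_top m) hle)
  have h0 := cycleOrder_ne_zero ρ c
  rw [← hn] at hle h0
  exact ⟨n, Nat.pos_of_ne_zero (by exact_mod_cast h0), by exact_mod_cast hle, hn.symm⟩

/-- The congruence pair `T(ρ)` of a special congruence `ρ`. -/
noncomputable def IsSpecial.pair {ρ : Con G.Inv} (hρ : IsSpecial ρ) : G.CongruencePair where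
  W := vertexSet ρ
  index_eq_one _ hv := hρ.index_eq_one hv
  f c := cycleOrder ρ c.1
  f_ne_zero c := cycleOrder_ne_zero ρ c.1
  f_rotate _ _ h := cycleOrder_eq_of_rotate ρ h

theorem IsSpecial.pair_toCon_le {ρ : Con G.Inv} (hρ : IsSpecial ρ) : hρ.pair.toCon ≤ ρ := by
  refine Con.conGen_le.2 ?_
  rintro _ _ (⟨e, he⟩ | ⟨c, m, h⟩)
  · obtain ⟨e', h1, h2⟩ := id he
    rwa [eq_of_index_eq_one (hρ.index_eq_one he) h1 rfl] at h2
  · exact rel_pow_of_cycleOrder_eq h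

theorem Inv.proj_cons (e : E) (l : List E) (b : V) :
    Inv.proj G (e :: l) b = Inv.edge G e * Inv.proj G l b * Inv.ghost G e := by
  simp only [Inv.proj, Inv.path_cons, Inv.ghostPath_cons, mul_assoc]

theorem Inv.proj_singleton (e : E) :
    Inv.proj G [e] (G.r e) = Inv.edge G e * Inv.ghost G e := by
  rw [Inv.proj_cons, Inv.proj, Inv.path_nil, Inv.ghostPath_nil, Inv.vertex_mul_self,
    Inv.edge_mul_range]

theorem IsPath.vertex_mul_proj {l : List E} {a b : V} (h : G.IsPath l a b) :
    Inv.vertex G a * Inv.proj G l b = Inv.proj G l b := by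
  rw [Inv.proj, ← mul_assoc, h.vertex_mul_path]

theorem IsPath.proj_mul_vertex {l : List E} {a b : V} (h : G.IsPath l a b) :
    Inv.proj G l b * Inv.vertex G a = Inv.proj G l b := by
  rw [Inv.proj, mul_assoc, h.ghostPath_mul_vertex]

/-- The projection collapses from the inside: `e (l l^*) e^*` becomes `e e^*`, which becomes `s(e)`.
-/
theorem IsPath.rel_proj_vertex {σ : Con G.Inv} {l : List E} {a b : V} (h : G.IsPath l a b)
    (hσ : ∀ e ∈ l, σ (Inv.edge G e * Inv.ghost G e) (Inv.vertex G (G.s e))) :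
    σ (Inv.proj G l b) (Inv.vertex G a) := by
  induction l generalizing a with
  | nil =>
    cases h
    rw [Inv.proj, Inv.path_nil, Inv.ghostPath_nil, Inv.vertex_mul_self]
    exact σ.refl _
  | cons e l ih =>
    have h1 := σ.mul (σ.mul (σ.refl (Inv.edge G e))
      (ih h.2 fun x hx => hσ x (List.mem_cons_of_mem e hx))) (σ.refl (Inv.ghost G e))
    rw [← Inv.proj_cons, Inv.edge_mul_range] at h1
    rw [← h.1]
    exact σ.trans h1 (hσ e List.mem_cons_self)

/-- For the path `e l`, multiplying by `e e^*` gives `e e^* ρ s(e)`, while compressing by `e^*` and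
`e` gives `r(e) ρ l l^*`, to which induction applies. -/
theorem IsPath.source_mem_vertexSet {ρ : Con G.Inv} {l : List E} {a b : V} (h : G.IsPath l a b)
    (hρ : ρ (Inv.vertex G a) (Inv.proj G l b)) : ∀ e ∈ l, G.s e ∈ vertexSet ρ := by
  induction l generalizing a with
  | nil => simp
  | cons e l ih =>
    obtain ⟨rfl, hl⟩ := h
    have he : G.IsPath [e] (G.s e) (G.r e) := by simp
    have h1 := ρ.mul (ρ.refl (Inv.proj G [e] (G.r e))) hρ
    have h2 := he.proj_mul_proj_append hl
    rw [List.singleton_append] at h2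
    rw [h2, he.proj_mul_vertex, Inv.proj_singleton] at h1
    have h3 := ρ.mul (ρ.mul (ρ.refl (Inv.ghost G e)) hρ) (ρ.refl (Inv.edge G e))
    rw [Inv.ghost_mul_source, Inv.ghost_mul_edge_self, Inv.proj_cons, mul_assoc, mul_assoc,
      Inv.ghost_mul_edge_self, ← mul_assoc, ← mul_assoc, Inv.ghost_mul_edge_self,
      hl.vertex_mul_proj, hl.proj_mul_vertex] at h3
    intro x hx
    rcases List.mem_cons.1 hx with rfl | hx
    · exact ⟨x, rfl, ρ.trans h1 (ρ.symm hρ)⟩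
    · exact ih hl h3 x hx

/-! ### Recovering a special congruence from its pair. -/

theorem IsSpecial.edge_rel {ρ : Con G.Inv} (hρ : IsSpecial ρ) {e : E}
    (he : G.s e ∈ vertexSet ρ) :
    hρ.pair.toCon (Inv.edge G e * Inv.ghost G e) (Inv.vertex G (G.s e)) :=
  ConGen.Rel.of _ _ (PairRel.edge e he)

theorem IsSpecial.cycle_pow_rel {ρ : Con G.Inv} (hρ : IsSpecial ρ) {c : G.GraphCycle}
    (hc : c ∈ G.cyclesIn (vertexSet ρ)) {k : ℕ} (h : ρ (c.pow k) (Inv.vertex G c.source)) :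
    hρ.pair.toCon (c.pow k) (Inv.vertex G c.source) := by
  induction k using Nat.strong_induction_on with
  | _ k ih =>
    rcases Nat.eq_zero_or_pos k with rfl | hk
    · exact Con.refl _ _
    obtain ⟨n, hn0, hnk, hn⟩ := exists_cycleOrder_eq hk h
    -- Division with remainder by the order `n`: subtracting `n` from the exponent preserves the
    -- hypothesis.
    obtain ⟨j, rfl⟩ : ∃ j, k = j + n := ⟨k - n, by omega⟩
    have h1 : hρ.pair.toCon (c.pow n) (Inv.vertex G c.source) :=
      ConGen.Rel.of _ _ (PairRel.cycle (P := hρ.pair) ⟨c, hc⟩ n hn)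
    have h2 : hρ.pair.toCon (c.pow (j + n)) (c.pow j) := by
      have := Con.mul _ (Con.refl _ (c.pow j)) h1
      rwa [← c.pow_add, c.pow_mul_vertex] at this
    exact Con.trans _ h2 (ih j (by omega) (ρ.trans (ρ.symm (hρ.pair_toCon_le h2)) h))

theorem IsSpecial.closed_path_rel {ρ : Con G.Inv} (hρ : IsSpecial ρ) {l : List E} {b : V}
    (hl : G.IsPath l b b) (hlW : ∀ e ∈ l, G.s e ∈ vertexSet ρ)
    (h : ρ (Inv.vertex G b) (Inv.path G l b)) :
    hρ.pair.toCon (Inv.path G l b) (Inv.vertex G b) := by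
  by_cases h0 : l = []
  · subst h0
    exact Con.refl _ _
  obtain ⟨c, hc, rfl, k, hk⟩ := exists_cycle_pow_eq (fun v hv => hρ.index_eq_one hv) h0 hl hlW
  rw [hk] at h ⊢
  exact hρ.cycle_pow_rel hc (ρ.symm h)

theorem IsSpecial.vertex_rel {ρ : Con G.Inv} (hρ : IsSpecial ρ) {v : V} {z : G.Inv}
    (h : ρ (Inv.vertex G v) z) : hρ.pair.toCon z (Inv.vertex G v) := by
  rcases eq_zero_or_isNormalForm z with rfl | ⟨p, q, a, a', b, hp, hq, rfl⟩
  · exact absurd h (hρ v)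
  obtain rfl : v = a := by
    by_contra hne
    have h1 := ρ.mul (ρ.refl (Inv.vertex G v)) h
    rw [Inv.vertex_mul_self, ← mul_assoc, hp.vertex_mul_path_of_ne hne, zero_mul] at h1
    exact hρ v h1
  obtain rfl : a' = v := by
    by_contra hne
    have h1 := ρ.mul h (ρ.refl (Inv.vertex G v))
    rw [Inv.vertex_mul_self, mul_assoc, hq.ghostPath_mul_vertex_of_ne hne, mul_zero] at h1
    exact hρ v h1
  -- The projection `p p^*` fixes `z = p q^*`, so `p p^* ρ p p^* z = z ρ v`.
  have hpp : ρ (Inv.vertex G a') (Inv.proj G p b) := by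
    have h1 := ρ.mul (ρ.refl (Inv.proj G p b)) h
    rw [hp.proj_mul_vertex, ← mul_assoc, hp.proj_mul_path] at h1
    exact ρ.trans h (ρ.symm h1)
  have hqq : ρ (Inv.vertex G a') (Inv.proj G q b) := by
    have h1 := ρ.mul h (ρ.refl (Inv.proj G q b))
    rw [hq.vertex_mul_proj, mul_assoc, hq.ghostPath_mul_proj] at h1
    exact ρ.trans h (ρ.symm h1)
  have hpW := hp.source_mem_vertexSet hpp
  have hqW := hq.source_mem_vertexSet hqq
  have hpσ := hp.rel_proj_vertex fun e he => hρ.edge_rel (hpW e he)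
  have hqσ := hq.rel_proj_vertex fun e he => hρ.edge_rel (hqW e he)
  have hmid := ρ.mul (ρ.mul (ρ.refl (Inv.ghostPath G q b)) h) (ρ.refl (Inv.path G q b))
  have hmid' := ρ.mul (ρ.mul (ρ.refl (Inv.ghostPath G p b)) h) (ρ.refl (Inv.path G p b))
  rw [hq.ghostPath_mul_vertex, hq.ghostPath_mul_path] at hmid
  rw [hp.ghostPath_mul_vertex, hp.ghostPath_mul_path] at hmid'
  rcases hp.comparable (fun v hv => hρ.index_eq_one hv) hq hpW with ⟨t, rfl⟩ | ⟨t, rfl⟩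
  -- Here `q = p t` and `z = p t^* p^*`. Compressing by `p` gives `r(p) ρ t^*`, hence `t ρ r(p)`
  -- with `t` closed.
  · obtain ⟨m, hm, ht⟩ := isPath_append.1 hq
    obtain rfl := hp.range_unique hm
    have htW : ∀ e ∈ t, G.s e ∈ vertexSet ρ := fun e he => hqW e (List.mem_append_right _ he)
    rw [ht.ghostPath_append, ← mul_assoc, hp.ghostPath_mul_path, mul_assoc, mul_assoc,
      hp.ghostPath_mul_path, ht.ghostPath_mul_vertex, vertex_mul_ghostPath] at hmid'
    have h1 := ρ.mul hmid' (ρ.refl (Inv.path G t b))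
    rw [ht.ghostPath_mul_path, ht.vertex_mul_path] at h1
    have h2 := Con.mul _ (Con.refl _ (Inv.ghostPath G t b))
      (hρ.closed_path_rel ht htW (ρ.symm h1))
    rw [ht.ghostPath_mul_path, ht.ghostPath_mul_vertex] at h2
    have h3 := Con.mul _ (Con.mul _ (Con.refl _ (Inv.path G p b)) h2)
      (Con.refl _ (Inv.ghostPath G p b))
    rw [path_mul_vertex, mul_assoc, ← ht.ghostPath_append] at h3
    exact Con.trans _ (Con.symm _ h3) hpσ
  -- Here `p = q t` and `z = q t q^*`, so compressing by `q` relates `t` itself to a vertex.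
  · obtain ⟨m, hm, ht⟩ := isPath_append.1 hp
    obtain rfl := hq.range_unique hm
    have htW : ∀ e ∈ t, G.s e ∈ vertexSet ρ := fun e he => hpW e (List.mem_append_right _ he)
    rw [ht.path_append, ← mul_assoc, ← mul_assoc, hq.ghostPath_mul_path, mul_assoc,
      hq.ghostPath_mul_path, ht.vertex_mul_path, path_mul_vertex] at hmid
    have h2 := hρ.closed_path_rel ht htW hmid
    have h3 := Con.mul _ (Con.mul _ (Con.refl _ (Inv.path G q b)) h2)
      (Con.refl _ (Inv.ghostPath G q b))
    rw [path_mul_vertex, ← ht.path_append] at h3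
    exact Con.trans _ h3 hqσ

theorem IsSpecial.pair_toCon_eq {ρ : Con G.Inv} (hρ : IsSpecial ρ) : hρ.pair.toCon = ρ := by
  refine le_antisymm hρ.pair_toCon_le ?_
  -- The compressed relation `r(p) ρ p^* y q` already lies in the generated congruence; multiplying
  -- back by `p` and `q^*` gives `x ~ p p^* y q q^*`.
  have key : ∀ {p q p' q' : List E} {a c b a' c' b' : V}, G.IsPath p a b → G.IsPath q c b →
      ρ (Inv.path G p b * Inv.ghostPath G q b) (Inv.path G p' b' * Inv.ghostPath G q' b') →
      hρ.pair.toCon (Inv.path G p b * Inv.ghostPath G q b)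
        (Inv.proj G p b * (Inv.path G p' b' * Inv.ghostPath G q' b') * Inv.proj G q b) := by
    intro p q p' q' a c b a' c' b' hp hq h
    have h1 := ρ.mul (ρ.mul (ρ.refl (Inv.ghostPath G p b)) h) (ρ.refl (Inv.path G q b))
    rw [← mul_assoc, hp.ghostPath_mul_path, mul_assoc, hq.ghostPath_mul_path,
      Inv.vertex_mul_self] at h1
    have h2 := Con.mul _ (Con.mul _ (Con.refl _ (Inv.path G p b)) (hρ.vertex_rel h1))
      (Con.refl _ (Inv.ghostPath G q b))
    rw [path_mul_vertex] at h2
    refine Con.symm _ ?_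
    simpa only [Inv.proj, mul_assoc] using h2
  intro x y h
  rcases eq_zero_or_isNormalForm x with rfl | hx
  · rcases eq_zero_or_isNormalForm y with rfl | hy
    · exact Con.refl _ _
    · exact absurd (ρ.symm h) (hρ.not_rel_zero hy)
  rcases eq_zero_or_isNormalForm y with rfl | hy
  · exact absurd h (hρ.not_rel_zero hx)
  obtain ⟨p, q, a, a', b, hp, hq, rfl⟩ := hx
  obtain ⟨p', q', c, c', d, hp', hq', rfl⟩ := hy
  have h1 := key (a' := c) (c' := c') hp hq h
  have h2 := key (a' := a) (c' := a') hp' hq' (ρ.symm h)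
  have h3 := Con.mul _ (Con.mul _ (Con.refl _ (Inv.proj G p b)) h2)
    (Con.refl _ (Inv.proj G q b))
  -- By commutation the outer projections move inward and are absorbed by `x = p q^*`, so both
  -- compressed elements are related.
  have h4 : Inv.proj G p b * (Inv.proj G p' d * (Inv.path G p b * Inv.ghostPath G q b) *
      Inv.proj G q' d) * Inv.proj G q b =
      Inv.proj G p' d * (Inv.path G p b * Inv.ghostPath G q b) * Inv.proj G q' d := by
    calc _ = (Inv.proj G p b * Inv.proj G p' d) * Inv.path G p b * (Inv.ghostPath G q b *
        (Inv.proj G q' d * Inv.proj G q b)) := by simp only [mul_assoc]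
      _ = Inv.proj G p' d * (Inv.proj G p b * Inv.path G p b) * ((Inv.ghostPath G q b *
        Inv.proj G q b) * Inv.proj G q' d) := by
        rw [hp.proj_mul_comm hp', hq'.proj_mul_comm hq]; simp only [mul_assoc]
      _ = _ := by rw [hp.proj_mul_path, hq.ghostPath_mul_proj]; simp only [mul_assoc]
  rw [h4] at h3
  exact Con.trans _ h1 (Con.trans _ h3 (Con.symm _ h2))

end Special

end DirectedGraph

/-! ### The semigroup of partial maps -/

/-- The partial maps from `X` to itself. -/
@[ext]
structure PartialMap (X : Type*) where
  /-- The value at a point, `none` if undefined. -/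
  eval : X → Option X

namespace PartialMap

variable {X : Type*}

instance : SemigroupWithZero (PartialMap X) where
  mul f g := ⟨fun x => (g.eval x).bind f.eval⟩
  zero := ⟨fun _ => none⟩
  mul_assoc _ _ _ := PartialMap.ext <| funext fun _ => (Option.bind_assoc _ _ _).symm
  zero_mul f := PartialMap.ext <| funext fun x => Option.bind_fun_none (f.eval x)
  mul_zero _ := rfl

theorem mul_eval (f g : PartialMap X) (x : X) : (f * g).eval x = (g.eval x).bind f.eval := rfl

theorem zero_eval (x : X) : (0 : PartialMap X).eval x = none := rfl

theorem eval_congr {f g : PartialMap X} (h : f = g) (x : X) : f.eval x = g.eval x := h ▸ rfl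

end PartialMap

namespace DirectedGraph

variable {V : Type u} {E : Type v}

/-! ### The universal property of the graph inverse semigroup. -/

section Lift

variable {G : DirectedGraph V E} {M : Type*} [SemigroupWithZero M]

/-- The extension of a map on the generators to the free semigroup with zero. -/
def wordLift (g : Gen V E → M) : FreeWords V E →ₙ* M where
  toFun := WithZero.recZeroCoe 0 (FreeSemigroup.lift g)
  map_mul' x y := by
    induction x using WithZero.recZeroCoe with
    | zero => rw [zero_mul]; exact (zero_mul _).symm
    | coe x =>
      induction y using WithZero.recZeroCoe with
      | zero => rw [mul_zero]; exact (mul_zero _).symm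
      | coe y => exact map_mul (FreeSemigroup.lift g) x y

theorem wordLift_word (g : Gen V E → M) (a : Gen V E) : wordLift g a.word = g a := rfl

theorem wordLift_zero (g : Gen V E → M) : wordLift g 0 = 0 := rfl

/-- The homomorphism from the graph inverse semigroup given by a map on the generators that
respects the relations. -/
def Inv.lift (g : Gen V E → M) (h : ∀ x y, InvRel G x y → wordLift g x = wordLift g y) :
    G.Inv →ₙ* M where
  toFun x := Con.liftOn x (wordLift g) fun _ _ hab =>
    (Con.conGen_le.2 h : conGen (InvRel G) ≤ Con.ker (wordLift g)) hab
  map_mul' x y := Con.induction_on₂ x y fun a b => map_mul (wordLift g) a b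

end Lift

/-! ### The action attached to a congruence pair -/

section Model

variable {G : DirectedGraph V E}

/-- Both `w` and a nonempty `t` would start at `b`, repeating a source. -/
theorem IsPath.eq_nil_of_nodup {w t : List E} {b : V} (hw0 : w ≠ []) (hw : G.IsPath w b b)
    (hwt : G.IsPath (w ++ t) b b) (hn : ((w ++ t).map G.s).Nodup) : t = [] := by
  by_contra ht0
  obtain ⟨m, hm, ht⟩ := isPath_append.1 hwt
  obtain rfl := hw.range_unique hm
  rw [List.map_append, List.nodup_append] at hn
  exact hn.2.2 _ (List.mem_map_of_mem (List.head_mem hw0)) _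
    (List.mem_map_of_mem (List.head_mem ht0)) ((hw.head_eq hw0).trans (ht.head_eq ht0).symm)

theorem GraphCycle.exists_isRotated_cons (c : G.GraphCycle) {e : E} (he : e ∈ c.edges) :
    ∃ l, c.edges ~r e :: l ∧ G.IsPath (e :: l) (G.s e) (G.s e) := by
  obtain ⟨x, y, hxy⟩ := List.append_of_mem he
  obtain ⟨m, hx, hy⟩ := isPath_append.1 (hxy ▸ c.isPath)
  obtain rfl := hy.1
  refine ⟨y ++ x, ?_, ?_⟩
  · rw [hxy]
    exact List.isRotated_append
  · exact isPath_append.2 ⟨_, hy, hx⟩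

/-- Two cycles through an edge all of whose vertices have index one agree up to rotation. -/
theorem isRotated_of_mem {W : Set V} (hW : ∀ v ∈ W, G.index v = 1) {c d : G.GraphCycle}
    (hc : c ∈ G.cyclesIn W) {e : E} (hec : e ∈ c.edges) (hed : e ∈ d.edges) :
    c.edges ~r d.edges := by
  obtain ⟨x, hcx, hx⟩ := c.exists_isRotated_cons hec
  obtain ⟨y, hdy, hy⟩ := d.exists_isRotated_cons hed
  suffices h : e :: x = e :: y from hcx.trans (h ▸ hdy.symm)
  have hcn : ((e :: x).map G.s).Nodup := (hcx.perm.map G.s).nodup_iff.1 c.nodup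
  have hdn : ((e :: y).map G.s).Nodup := (hdy.perm.map G.s).nodup_iff.1 d.nodup
  rcases hx.comparable hW hy (fun f hf => hc ⟨f, hcx.mem_iff.2 hf, rfl⟩) with ⟨t, ht⟩ | ⟨t, ht⟩
  · have h0 : t = [] := hx.eq_nil_of_nodup (List.cons_ne_nil _ _) (ht ▸ hy) (ht ▸ hdn)
    rw [ht, h0, List.append_nil]
  · have h0 : t = [] := hy.eq_nil_of_nodup (List.cons_ne_nil _ _) (ht ▸ hx) (ht ▸ hcn)
    rw [ht, h0, List.append_nil]

namespace CongruencePair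

variable (P : G.CongruencePair)

open Classical in
/-- The order of the translation by which an edge acts: `f(c) * |c|` for the edges of a cycle `c`
inside `W` with `f(c) < ∞`, and `0` (infinite order) for all other edges. -/
noncomputable def weightOrder (e : E) : ℕ :=
  if h : ∃ c : G.cyclesIn P.W, e ∈ c.1.edges then
    (P.f h.choose).toNat * h.choose.1.edges.length else 0

/-- The chosen cycle does not matter: cycles in `W` sharing an edge are rotations of each other,
with equal length and equal `f`. -/
theorem weightOrder_eq (c : G.cyclesIn P.W) {e : E} (he : e ∈ c.1.edges) :
    P.weightOrder e = (P.f c).toNat * c.1.edges.length := by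
  have h : ∃ c : G.cyclesIn P.W, e ∈ c.1.edges := ⟨c, he⟩
  have hr := isRotated_of_mem P.index_eq_one h.choose.2 h.choose_spec he
  rw [weightOrder, dif_pos h, P.f_rotate _ _ hr, hr.perm.length_eq]

/-- The translation by which an edge acts. -/
noncomputable def weight (e : E) : ∀ n, ZMod n := Pi.single (P.weightOrder e) 1

/-- The set on which the graph inverse semigroup acts. -/
abbrev Space (_ : G.CongruencePair) : Type (max u v) := V × List E × (∀ n, ZMod n)

open Classical in
/-- The action of an edge. -/
noncomputable def edgeMap (e : E) : PartialMap P.Space where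
  eval x :=
  if x.1 = G.r e then
    if G.s e ∈ P.W then some (G.s e, x.2.1, x.2.2 + P.weight e)
    else some (G.s e, e :: x.2.1, x.2.2)
  else none

open Classical in
/-- The action of a ghost edge. -/
noncomputable def ghostMap (e : E) : PartialMap P.Space where
  eval x :=
  if x.1 = G.s e then
    if G.s e ∈ P.W then some (G.r e, x.2.1, x.2.2 - P.weight e)
    else if x.2.1.head? = some e then some (G.r e, x.2.1.tail, x.2.2) else none
  else none

open Classical in
/-- The action of a vertex. -/
noncomputable def vertexMap (v : V) : PartialMap P.Space where
  eval x := if x.1 = v then some x else none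

/-- The action of the generators. -/
noncomputable def genMap : Gen V E → PartialMap P.Space
  | .vertex v => P.vertexMap v
  | .edge e => P.edgeMap e
  | .ghost e => P.ghostMap e

theorem wordLift_genMap_eq {x y : FreeWords V E} (h : InvRel G x y) :
    wordLift P.genMap x = wordLift P.genMap y := by
  cases h <;> simp only [map_mul, wordLift_word, wordLift_zero, genMap] <;>
    ext1 <;> funext ⟨w, l, b⟩ <;>
    simp only [PartialMap.mul_eval, PartialMap.zero_eval, vertexMap, edgeMap, ghostMap]
  case vertex_mul_self v => split_ifs <;> simp_all
  case vertex_mul_of_ne u v h => split_ifs <;> simp_all [Ne.symm h]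
  case source_mul_edge e => split_ifs <;> simp
  case edge_mul_range e => split_ifs <;> simp_all
  case range_mul_ghost e => split_ifs <;> simp
  case ghost_mul_source e => split_ifs <;> simp_all
  case ghost_mul_self e => split_ifs <;> simp_all
  case ghost_mul_of_ne f e h =>
    -- Distinct edges with a common source force it outside `W`, where the top of the stack is `e`
    -- and blocks `f^*`.
    by_cases hs : G.s e = G.s f
    · have hW : G.s f ∉ P.W := fun hf => h (eq_of_index_eq_one (P.index_eq_one _ hf) rfl hs)
      have hW' : G.s e ∉ P.W := hs ▸ hW
      split_ifs <;> simp [hs, Ne.symm h]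
    · split_ifs <;> simp [hs]

/-- The action of the graph inverse semigroup attached to a congruence pair. -/
noncomputable def action : G.Inv →ₙ* PartialMap P.Space :=
  Inv.lift P.genMap fun _ _ h => P.wordLift_genMap_eq h

theorem action_vertex (v : V) : P.action (Inv.vertex G v) = P.vertexMap v := rfl

theorem action_edge (e : E) : P.action (Inv.edge G e) = P.edgeMap e := rfl

theorem action_ghost (e : E) : P.action (Inv.ghost G e) = P.ghostMap e := rfl

theorem action_zero : P.action 0 = 0 := rfl

theorem vertexMap_self (v : V) (l : List E) (g : ∀ n, ZMod n) :
    (P.vertexMap v).eval (v, l, g) = some (v, l, g) := if_pos rfl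

theorem action_path_apply {p : List E} {a b : V} (hp : G.IsPath p a b)
    (hpW : ∀ e ∈ p, G.s e ∈ P.W) (l : List E) (g : ∀ n, ZMod n) :
    (P.action (Inv.path G p b)).eval (b, l, g) = some (a, l, g + (p.map P.weight).sum) := by
  induction p generalizing a with
  | nil =>
    cases hp
    rw [Inv.path_nil, action_vertex, vertexMap_self]
    simp
  | cons e p ih =>
    obtain ⟨rfl, hp'⟩ := hp
    rw [Inv.path_cons, map_mul, PartialMap.mul_eval,
      ih hp' fun x hx => hpW x (List.mem_cons_of_mem e hx), action_edge]
    simp [edgeMap, hpW e List.mem_cons_self, add_left_comm, add_comm]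

theorem sum_weight_cycle (c : G.cyclesIn P.W) :
    (c.1.edges.map P.weight).sum = c.1.edges.length •
      (Pi.single ((P.f c).toNat * c.1.edges.length) 1 : ∀ n, ZMod n) := by
  rw [List.map_congr_left (g := fun _ => Pi.single ((P.f c).toNat * c.1.edges.length) 1)
    fun e he => by rw [weight, P.weightOrder_eq c he]]
  simp

theorem action_pow_apply (c : G.cyclesIn P.W) (m : ℕ) (l : List E) (g : ∀ n, ZMod n) :
    (P.action (c.1.pow m)).eval (c.1.source, l, g) = some (c.1.source, l, g + (m * c.1.edges.length) •
      (Pi.single ((P.f c).toNat * c.1.edges.length) 1 : ∀ n, ZMod n)) := by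
  induction m generalizing g with
  | zero => simpa [GraphCycle.pow, action_vertex] using P.vertexMap_self c.1.source l g
  | succ m ih =>
    rw [GraphCycle.pow_succ, map_mul, PartialMap.mul_eval,
      P.action_path_apply c.1.isPath fun e he => c.2 ⟨e, he, rfl⟩, Option.bind_some, ih,
      sum_weight_cycle, add_assoc, ← add_nsmul]
    congr 5
    ring

/-- For `N = 0` the coordinate is `ZMod 0 = ℤ`, and divisibility by `0` expresses infinite order. -/
theorem nsmul_single_eq_zero_iff (N k : ℕ) :
    k • (Pi.single N 1 : ∀ n, ZMod n) = 0 ↔ N ∣ k := by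
  rw [← Pi.single_smul, Pi.single_eq_zero_iff, nsmul_one, ZMod.natCast_eq_zero_iff]

/-- At its source `c^m` translates by `m |c|` times an element of order `f(c) |c|`. The value `f(c)
= ∞` becomes `0` under `toNat`, so only `m = 0` is allowed. -/
theorem action_pow_eq_iff (c : G.cyclesIn P.W) (m : ℕ) :
    P.action (c.1.pow m) = P.action (Inv.vertex G c.1.source) ↔ (P.f c).toNat ∣ m := by
  have hlen : 0 < c.1.edges.length := List.length_pos_of_ne_nil c.1.ne_nil
  rw [← Nat.mul_dvd_mul_iff_right hlen, ← nsmul_single_eq_zero_iff]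
  constructor
  · intro h
    have h1 := PartialMap.eval_congr h (c.1.source, [], 0)
    rw [action_pow_apply, action_vertex, vertexMap_self] at h1
    simpa using h1
  · intro h
    ext1
    funext ⟨v, l, g⟩
    by_cases hv : v = c.1.source
    · subst hv
      rw [action_pow_apply, h, add_zero, action_vertex, vertexMap_self]
    · rw [← c.1.pow_mul_vertex, map_mul, PartialMap.mul_eval, action_vertex]
      simp [vertexMap, hv]

theorem toCon_le_ker : P.toCon ≤ Con.ker P.action := by
  refine Con.conGen_le.2 ?_
  rintro _ _ (⟨e, he⟩ | ⟨c, m, h⟩)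
  · change P.action (Inv.edge G e * Inv.ghost G e) = P.action (Inv.vertex G (G.s e))
    rw [map_mul, action_edge, action_ghost, action_vertex]
    ext1
    funext ⟨v, l, g⟩
    rw [PartialMap.mul_eval]
    by_cases hv : v = G.s e <;> simp [edgeMap, ghostMap, vertexMap, he, hv]
  · refine (P.action_pow_eq_iff c m).2 ?_
    rw [h, ENat.toNat_natCast]

theorem action_eq_of_toCon {x y : G.Inv} (h : P.toCon x y) : P.action x = P.action y :=
  P.toCon_le_ker h

/-! ### Recovering a pair from the congruence it generates. -/

theorem isSpecial_toCon : IsSpecial P.toCon := fun v h => by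
  have h1 := PartialMap.eval_congr (P.action_eq_of_toCon h) (v, [], 0)
  rw [action_vertex, vertexMap_self, action_zero, PartialMap.zero_eval] at h1
  exact Option.some_ne_none _ h1

theorem vertexSet_toCon : vertexSet P.toCon = P.W := by
  ext v
  constructor
  · rintro ⟨e, rfl, h⟩
    by_contra hv
    -- With an empty stack and `s(e) ∉ W`, the ghost edge has nothing to pop and is undefined, while
    -- the vertex is defined.
    have h1 := PartialMap.eval_congr (P.action_eq_of_toCon h) (G.s e, [], 0)
    rw [action_vertex, vertexMap_self, map_mul, PartialMap.mul_eval, action_ghost] at h1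
    simp [ghostMap, hv] at h1
  · intro hv
    obtain ⟨e, rfl⟩ := exists_edge_of_index_eq_one (P.index_eq_one v hv)
    exact ⟨e, rfl, ConGen.Rel.of _ _ (PairRel.edge e hv)⟩

theorem cycleOrder_toCon (c : G.cyclesIn P.W) : cycleOrder P.toCon c.1 = P.f c := by
  refine le_antisymm ?_ (le_sInf ?_)
  · by_cases htop : P.f c = ⊤
    · rw [htop]
      exact le_top
    · obtain ⟨n, hn⟩ := ENat.ne_top_iff_exists.1 htop
      refine sInf_le ⟨n, hn.symm, ?_, ConGen.Rel.of _ _ (PairRel.cycle c n hn.symm)⟩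
      refine Nat.pos_of_ne_zero fun h0 => P.f_ne_zero c ?_
      rw [← hn, h0, Nat.cast_zero]
  · rintro _ ⟨m, rfl, hm, h⟩
    have hdvd := (P.action_pow_eq_iff c m).1 (P.action_eq_of_toCon h)
    by_cases htop : P.f c = ⊤
    · rw [htop, ENat.toNat_top, zero_dvd_iff] at hdvd
      exact absurd hdvd hm.ne'
    · rw [← ENat.natCast_toNat htop]
      exact_mod_cast Nat.le_of_dvd hm hdvd

theorem ext_of_isPairOf {ρ : Con G.Inv} {P Q : G.CongruencePair} (hP : IsPairOf ρ P)
    (hQ : IsPairOf ρ Q) : P = Q := by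
  obtain ⟨W, h1, f, h2, h3⟩ := P
  obtain ⟨W', h1', f', h2', h3'⟩ := Q
  obtain ⟨rfl, hf⟩ := hP
  obtain ⟨hW, hf'⟩ := hQ
  -- The domain of the cycle function depends on `W`, so the sets are identified before the
  -- functions are compared.
  dsimp only at hW
  subst hW
  obtain rfl : f = f' := funext fun c => (hf c).trans (hf' c).symm
  rfl

theorem isPairOf_toCon : IsPairOf P.toCon P :=
  ⟨P.vertexSet_toCon.symm, fun c => (P.cycleOrder_toCon c).symm⟩

end CongruencePair

theorem IsSpecial.isPairOf_pair {ρ : Con G.Inv} (hρ : IsSpecial ρ) : IsPairOf ρ hρ.pair :=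
  ⟨rfl, fun _ => rfl⟩

end Model

end DirectedGraph

/-- There are mutually inverse maps `T` from special congruences to congruence pairs and `℘` from
congruence pairs to special congruences (both well defined), given by the stated formulas. -/
theorem theorem1p1 {V : Type u} {E : Type v} (G : DirectedGraph V E) :
    ∃ (T : G.SpecialCongruence → G.CongruencePair) (wp : G.CongruencePair → G.SpecialCongruence),
      (∀ ρ : G.SpecialCongruence, DirectedGraph.IsPairOf ρ.1 (T ρ)) ∧
      (∀ P : G.CongruencePair, (wp P).1 = P.toCon) ∧
      Function.LeftInverse wp T ∧
      Function.RightInverse wp T ∧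
      Function.Bijective T := by
  have hl : Function.LeftInverse
      (fun P : G.CongruencePair => (⟨P.toCon, P.isSpecial_toCon⟩ : G.SpecialCongruence))
      (fun ρ => ρ.2.pair) := fun ρ => Subtype.ext ρ.2.pair_toCon_eq
  have hr : Function.RightInverse
      (fun P : G.CongruencePair => (⟨P.toCon, P.isSpecial_toCon⟩ : G.SpecialCongruence))
      (fun ρ => ρ.2.pair) := fun P =>
    DirectedGraph.CongruencePair.ext_of_isPairOf P.isSpecial_toCon.isPairOf_pair P.isPairOf_toCon
  exact ⟨fun ρ => ρ.2.pair, fun P => ⟨P.toCon, P.isSpecial_toCon⟩, fun ρ => ρ.2.isPairOf_pair,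
    fun _ => rfl, hl, hr, hl.injective, hr.surjective⟩
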